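/- Let $q:(0,\pi)\to\mathbb{R}$ be summable (Lebesgue integrable), $\gamma\in(0,\pi]$ and $\delta\in[0,\pi)$. Let $L(q,\gamma,\delta)$ be the Sturm--Liouville operator in $L^2(0,\pi)$ (with complex-valued functions) acting by $y\mapsto -y''+q\,y$ on those $y$ for which $y$ and $y'$ are absolutely continuous on $[0,\pi]$, $-y''+qy\in L^2(0,\pi)$, and $$y(0)\cos\gamma+y'(0)\sin\gamma=0,\qquad y(\pi)\cos\delta+y'(\pi)\sin\delta=0.$$ Then all eigenvalues of $L(q,\gamma,\delta)$ are real and there is a lowest one, denoted $\mu_0(q,\gamma,\delta)$; the same holds for $L(0,\gamma,\delta)$, the operator with zero potential; and $$\operatorname*{ess\,inf}_{(0,\pi)} q\;\le\;\mu_0(q,\gamma,\delta)-\mu_0(0,\gamma,\delta)\;\le\;\operatorname*{ess\,sup}_{(0,\pi)} q,$$ where the essential infimum and supremum are taken with respect to Lebesgue measure in the extended reals $[-\infty,+\infty]$. -/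

import Mathlib

open MeasureTheory

namespace SturmLiouville

/-- The derivative `y'` of a function on `[0, π]`, one-sided at the endpoints. -/
noncomputable def D (y : ℝ → ℂ) : ℝ → ℂ :=
  derivWithin y (Set.Icc 0 Real.pi)

/-- Lebesgue measure on the interval `(0, π)`. -/
noncomputable def vol : Measure ℝ := volume.restrict (Set.Ioo 0 Real.pi)

/-- The differential expression `-y'' + q y`. It is used only where `y'` is absolutely continuous
on `[0, π]`, so that `y''` exists almost everywhere. -/
noncomputable def expr (q : ℝ → ℝ) (y : ℝ → ℂ) (x : ℝ) : ℂ :=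
  -deriv (D y) x + (q x : ℂ) * y x

/-- The domain of the operator `L(q, γ, δ)` in `L²(0, π)`: the functions `y` that are
differentiable on `[0, π]` with `y'` absolutely continuous there, with `-y'' + q y ∈ L²(0, π)`, and
that satisfy the two boundary conditions. -/
structure InDomain (q : ℝ → ℝ) (γ δ : ℝ) (y : ℝ → ℂ) : Prop where
  differentiableOn : DifferentiableOn ℝ y (Set.Icc 0 Real.pi)
  absolutelyContinuous : AbsolutelyContinuousOnInterval (D y) 0 Real.pi
  memLp : MemLp (expr q y) 2 vol
  boundary_left : y 0 * (Real.cos γ : ℂ) + D y 0 * (Real.sin γ : ℂ) = 0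
  boundary_right : y Real.pi * (Real.cos δ : ℂ) + D y Real.pi * (Real.sin δ : ℂ) = 0

/-- `μ ∈ ℂ` is an eigenvalue of `L(q, γ, δ)`: there is a `y` in the domain, not identically zero
on `[0, π]`, with `-y'' + q y = μ y` almost everywhere on `(0, π)`. -/
def IsEigenvalue (q : ℝ → ℝ) (γ δ : ℝ) (μ : ℂ) : Prop :=
  ∃ y : ℝ → ℂ, InDomain q γ δ y ∧ (∃ x ∈ Set.Icc 0 Real.pi, y x ≠ 0) ∧
    ∀ᵐ x ∂vol, expr q y x = μ * y x

/-- The real number `m` is the lowest eigenvalue of `L(q, γ, δ)`: it is an eigenvalue, and every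
eigenvalue is real and at least `m`. -/
def IsLowestEigenvalue (q : ℝ → ℝ) (γ δ : ℝ) (m : ℝ) : Prop :=
  IsEigenvalue q γ δ (m : ℂ) ∧ ∀ μ : ℂ, IsEigenvalue q γ δ μ → μ.im = 0 ∧ m ≤ μ.re

/-- `μ₀(q, γ, δ)`, as the infimum of the real eigenvalues. That this infimum is attained, and is
the lowest eigenvalue, is expressed by `IsLowestEigenvalue q γ δ (mu0 q γ δ)`. -/
noncomputable def mu0 (q : ℝ → ℝ) (γ δ : ℝ) : ℝ :=
  sInf {m : ℝ | IsEigenvalue q γ δ (m : ℂ)}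

end SturmLiouville

/-!
By Green's identity for the Wronskian of two eigenfunctions `y` and `z`, for potentials `q` and `p`
and eigenvalues `μ` and `ν`, the integral of `(μ - ν - (q - p)) y z` over `[0, π]` vanishes. With
`z` the conjugate of `y` this shows that eigenvalues are real; with `y` and `z` positive on `(0, π)`
it shows that `μ - ν` lies between the essential bounds of `q - p`, and in particular that at most
one eigenvalue has a positive eigenfunction.

It remains to find a positive eigenfunction at or below every eigenvalue. Let `Q` be the primitive
of `q` minus its mean, and write the equation as a system for `y` and the quasi-derivative
`y' - Q y`, whose coefficients are continuous. Its Prüfer angle `θ`, started at the angle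
`α ∈ [0, π)` given by the boundary condition at `0`, can only cross multiples of `π` upwards, so
`y` is positive on `(0, π)` as soon as `θ` reaches at `π` the least admissible angle
`β ∈ (0, π]`. At an eigenvalue `l`, and for all large `l`, one has `θ π ≥ β`, while
`θ π ≤ β` for `l` near `-∞`, so the intermediate value theorem in `l` applies.
-/

namespace SturmLiouville

open Set Filter Topology Real

section AbsolutelyContinuous

variable {X Y : Type*} [PseudoMetricSpace X] [PseudoMetricSpace Y] {a b : ℝ}

theorem absolutelyContinuousOnInterval_of_dist_le {f : ℝ → X} {g : ℝ → Y}
    (hg : AbsolutelyContinuousOnInterval g a b)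
    (h : ∀ x ∈ uIcc a b, ∀ y ∈ uIcc a b, dist (f x) (f y) ≤ dist (g x) (g y)) :
    AbsolutelyContinuousOnInterval f a b := by
  rw [absolutelyContinuousOnInterval_iff] at hg ⊢
  intro ε hε
  obtain ⟨η, hη, hgη⟩ := hg ε hε
  refine ⟨η, hη, fun E hE hlt => lt_of_le_of_lt ?_ (hgη E hE hlt)⟩
  exact Finset.sum_le_sum fun i hi => h _ (hE.1 i hi).1 _ (hE.1 i hi).2

theorem absolutelyContinuousOnInterval_congr {f g : ℝ → X}
    (hf : AbsolutelyContinuousOnInterval f a b) (h : EqOn f g (uIcc a b)) :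
    AbsolutelyContinuousOnInterval g a b :=
  absolutelyContinuousOnInterval_of_dist_le hf fun x hx y hy => by rw [h hx, h hy]

variable {E : Type*} [NormedAddCommGroup E] [NormedSpace ℝ E] {f f' : ℝ → E}

theorem absolutelyContinuousOnInterval_of_hasDerivWithinAt (hab : a ≤ b)
    (hf : ∀ x ∈ Icc a b, HasDerivWithinAt f (f' x) (Icc a b) x)
    (hf' : ContinuousOn f' (Icc a b)) : AbsolutelyContinuousOnInterval f a b := by
  obtain ⟨C, hC⟩ := isCompact_Icc.exists_bound_of_continuousOn hf'
  have hlip := (convex_Icc a b).lipschitzOnWith_of_nnnorm_hasDerivWithin_le (C := C.toNNReal) hf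
    fun x hx => NNReal.le_toNNReal_of_coe_le (hC x hx)
  rw [← uIcc_of_le hab] at hlip
  exact hlip.absolutelyContinuousOnInterval

theorem absolutelyContinuousOnInterval_integral (hf : IntervalIntegrable f volume a b) :
    AbsolutelyContinuousOnInterval (fun x => ∫ t in a..x, f t) a b := by
  refine absolutelyContinuousOnInterval_of_dist_le
    (hf.norm.absolutelyContinuousOnInterval_intervalIntegral left_mem_uIcc) fun x hx y hy => ?_
  have hsub : ∀ z ∈ uIcc a b, IntervalIntegrable f volume a z := fun z hz =>
    hf.mono_set (uIcc_subset_uIcc_left hz)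
  rw [dist_eq_norm, Real.dist_eq, intervalIntegral.integral_interval_sub_left (hsub x hx)
    (hsub y hy), intervalIntegral.integral_interval_sub_left (hsub x hx).norm (hsub y hy).norm]
  exact intervalIntegral.norm_integral_le_abs_integral_norm

theorem integral_eq_sub_of_absolutelyContinuousOnInterval [CompleteSpace E]
    (hf : AbsolutelyContinuousOnInterval f a b)
    (hderiv : ∀ᵐ x, x ∈ uIcc a b → HasDerivAt f (f' x) x)
    (hf' : IntervalIntegrable f' volume a b) : ∫ x in a..b, f' x = f b - f a := by
  have hdiff : ∀ᵐ x, x ∈ uIcc a b → HasDerivAt (fun x => f x - ∫ t in a..x, f' t) 0 x := by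
    filter_upwards [hderiv, hf'.ae_hasDerivAt_integral] with x hx hint hxab
    simpa using (hx hxab).fun_sub (hint hxab a left_mem_uIcc)
  obtain ⟨C, hC⟩ :=
    (hf.fun_sub (absolutelyContinuousOnInterval_integral hf')).const_of_ae_hasDerivAt_zero hdiff
  have ha := hC a left_mem_uIcc
  have hb := hC b right_mem_uIcc
  simp only [intervalIntegral.integral_same, sub_zero] at ha hb
  rw [ha, ← hb, sub_sub_cancel]

theorem ae_differentiableAt_of_absolutelyContinuousOnInterval [FiniteDimensional ℝ E]
    (hf : AbsolutelyContinuousOnInterval f a b) :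
    ∀ᵐ x, x ∈ uIcc a b → DifferentiableAt ℝ f x :=
  hf.boundedVariationOn.ae_differentiableAt_of_mem_uIcc

end AbsolutelyContinuous

theorem intervalIntegral_pos_of_ae_pos {f : ℝ → ℝ} {a b : ℝ} (hab : a < b)
    (hf : IntervalIntegrable f volume a b) (hpos : ∀ᵐ x ∂volume.restrict (Ioo a b), 0 < f x) :
    0 < ∫ x in a..b, f x := by
  have hsupp : Function.support f =ᵐ[volume.restrict (Ioo a b)] univ :=
    eventuallyEq_univ.2 (hpos.mono fun x hx => hx.ne')
  rw [intervalIntegral.integral_of_le hab.le, integral_Ioc_eq_integral_Ioo,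
    integral_pos_iff_support_of_nonneg_ae (hpos.mono fun x hx => hx.le)
      ((intervalIntegrable_iff_integrableOn_Ioo_of_le hab.le).1 hf), measure_congr hsupp]
  simpa using hab

theorem ae_vol_mem_Ioo : ∀ᵐ x ∂vol, x ∈ Ioo 0 π :=
  ae_restrict_mem measurableSet_Ioo

theorem ae_vol_iff {p : ℝ → Prop} : (∀ᵐ x ∂vol, p x) ↔ ∀ᵐ x, x ∈ uIcc 0 π → p x := by
  rw [vol, Measure.restrict_congr_set Ioo_ae_eq_Icc, ← uIcc_of_le pi_pos.le,
    ae_restrict_iff' measurableSet_uIcc]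

theorem D_eq {y : ℝ → ℂ} {v : ℂ} {x : ℝ} (hx : x ∈ Icc 0 π)
    (h : HasDerivWithinAt y v (Icc 0 π) x) : D y x = v :=
  h.derivWithin (uniqueDiffOn_Icc pi_pos x hx)

/-- A solution on `[0, π]` of `-y'' + q y = μ y`, in the sense in which the equation is understood
in `IsEigenvalue`, but with no boundary conditions. -/
structure IsSolution (q : ℝ → ℝ) (μ : ℂ) (y : ℝ → ℂ) : Prop where
  differentiableOn : DifferentiableOn ℝ y (Icc 0 π)
  absolutelyContinuous : AbsolutelyContinuousOnInterval (D y) 0 π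
  ae_eq : ∀ᵐ x ∂vol, expr q y x = μ * y x

/-- The Wronskian `y z' - y' z` on `[0, π]`. -/
noncomputable def wronskian (y z : ℝ → ℂ) (x : ℝ) : ℂ := y x * D z x - D y x * z x

theorem wronskian_eq_zero_of_boundary {y z : ℝ → ℂ} {x γ : ℝ}
    (hy : y x * (cos γ : ℂ) + D y x * (sin γ : ℂ) = 0)
    (hz : z x * (cos γ : ℂ) + D z x * (sin γ : ℂ) = 0) : wronskian y z x = 0 := by
  have hsc : (sin γ : ℂ) ^ 2 + (cos γ : ℂ) ^ 2 = 1 := mod_cast sin_sq_add_cos_sq γ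
  rw [wronskian]
  linear_combination (cos γ * D z x - sin γ * z x) * hy -
    (cos γ * D y x - sin γ * y x) * hz - (y x * D z x - D y x * z x) * hsc

namespace IsSolution

variable {q p : ℝ → ℝ} {μ ν : ℂ} {y z v : ℝ → ℂ}

theorem of_hasDerivAt (hy : ∀ x ∈ Icc 0 π, HasDerivWithinAt y (v x) (Icc 0 π) x)
    (hv : AbsolutelyContinuousOnInterval v 0 π)
    (hv' : ∀ᵐ x ∂vol, HasDerivAt v ((q x - μ) * y x) x) : IsSolution q μ y where
  differentiableOn x hx := (hy x hx).differentiableWithinAt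
  absolutelyContinuous := absolutelyContinuousOnInterval_congr hv fun x hx => by
    rw [uIcc_of_le pi_pos.le] at hx
    exact (D_eq hx (hy x hx)).symm
  ae_eq := by
    filter_upwards [hv', ae_vol_mem_Ioo] with x hx hx'
    have hD : D y =ᶠ[𝓝 x] v := by
      filter_upwards [Icc_mem_nhds hx'.1 hx'.2] with t ht using D_eq ht (hy t ht)
    rw [expr, hD.deriv_eq, hx.deriv]
    ring

theorem hasDerivWithinAt (hy : IsSolution q μ y) {x : ℝ} (hx : x ∈ Icc 0 π) :
    HasDerivWithinAt y (D y x) (Icc 0 π) x :=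
  (hy.differentiableOn x hx).hasDerivWithinAt

theorem continuousOn (hy : IsSolution q μ y) : ContinuousOn y (Icc 0 π) :=
  hy.differentiableOn.continuousOn

theorem absolutelyContinuous_self (hy : IsSolution q μ y) :
    AbsolutelyContinuousOnInterval y 0 π :=
  absolutelyContinuousOnInterval_of_hasDerivWithinAt pi_pos.le
    (fun _ hx => hy.hasDerivWithinAt hx)
    (uIcc_of_le pi_pos.le ▸ hy.absolutelyContinuous.continuousOn)

theorem ae_hasDerivAt (hy : IsSolution q μ y) : ∀ᵐ x ∂vol, HasDerivAt y (D y x) x := by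
  filter_upwards [ae_vol_mem_Ioo] with x hx
  exact (hy.hasDerivWithinAt (Ioo_subset_Icc_self hx)).hasDerivAt (Icc_mem_nhds hx.1 hx.2)

theorem ae_hasDerivAt_D (hy : IsSolution q μ y) :
    ∀ᵐ x ∂vol, HasDerivAt (D y) ((q x - μ) * y x) x := by
  filter_upwards [ae_vol_iff.2 (ae_differentiableAt_of_absolutelyContinuousOnInterval
    hy.absolutelyContinuous), hy.ae_eq] with x hx hxe
  refine hx.hasDerivAt.congr_deriv ?_
  rw [expr] at hxe
  linear_combination -hxe

theorem conj (hy : IsSolution q μ y) :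
    IsSolution q (starRingEnd ℂ μ) fun x => starRingEnd ℂ (y x) := by
  refine of_hasDerivAt (v := fun x => starRingEnd ℂ (D y x)) (fun x hx => ?_) ?_ ?_
  · exact (hy.hasDerivWithinAt hx).star
  · exact absolutelyContinuousOnInterval_of_dist_le hy.absolutelyContinuous fun s _ t _ =>
      (Complex.dist_conj_conj _ _).le
  · filter_upwards [hy.ae_hasDerivAt_D] with x hx
    exact hx.star.congr_deriv (by simp)

theorem absolutelyContinuous_wronskian (hy : IsSolution q μ y) (hz : IsSolution p ν z) :
    AbsolutelyContinuousOnInterval (wronskian y z) 0 π :=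
  (hy.absolutelyContinuous_self.fun_smul hz.absolutelyContinuous).fun_sub
    (hy.absolutelyContinuous.fun_smul hz.absolutelyContinuous_self)

theorem ae_hasDerivAt_wronskian (hy : IsSolution q μ y) (hz : IsSolution p ν z) :
    ∀ᵐ x ∂vol, HasDerivAt (wronskian y z) ((μ - ν - (q x - p x)) * (y x * z x)) x := by
  filter_upwards [hy.ae_hasDerivAt, hy.ae_hasDerivAt_D, hz.ae_hasDerivAt, hz.ae_hasDerivAt_D]
    with x hyx hDy hzx hDz
  exact ((hyx.mul hDz).sub (hDy.mul hzx)).congr_deriv (by ring)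

theorem wronskian_eq (hy : IsSolution q μ y) (hz : IsSolution q μ z) {x : ℝ}
    (hx : x ∈ Icc 0 π) : wronskian y z x = wronskian y z 0 := by
  obtain ⟨C, hC⟩ := (hy.absolutelyContinuous_wronskian hz).const_of_ae_hasDerivAt_zero <|
    ae_vol_iff.1 <| (hy.ae_hasDerivAt_wronskian hz).mono fun x hx => by simpa using hx
  rw [hC x (uIcc_of_le pi_pos.le ▸ hx), hC 0 left_mem_uIcc]

theorem integral_eq_wronskian_sub (hq : IntervalIntegrable q volume 0 π)
    (hp : IntervalIntegrable p volume 0 π) (hy : IsSolution q μ y) (hz : IsSolution p ν z) :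
    ∫ x in (0 : ℝ)..π, (μ - ν - (q x - p x)) * (y x * z x) =
      wronskian y z π - wronskian y z 0 := by
  have hqp : IntervalIntegrable (fun x => (q x - p x : ℂ)) volume 0 π :=
    IntervalIntegrable.sub ⟨hq.1.ofReal, hq.2.ofReal⟩ ⟨hp.1.ofReal, hp.2.ofReal⟩
  refine integral_eq_sub_of_absolutelyContinuousOnInterval (hy.absolutelyContinuous_wronskian hz)
    (ae_vol_iff.1 (hy.ae_hasDerivAt_wronskian hz))
    ((intervalIntegrable_const.sub hqp).mul_continuousOn ?_)
  rw [uIcc_of_le pi_pos.le]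
  exact hy.continuousOn.mul hz.continuousOn

/-- The third solution `v` takes the place of uniqueness for initial value problems. -/
theorem exists_eq_const_mul (hy : IsSolution q μ y) (hz : IsSolution q μ z) (hv : IsSolution q μ v)
    (hyz : wronskian y z 0 = 0) (hyv : wronskian y v 0 ≠ 0) :
    ∃ c, ∀ x ∈ Icc 0 π, z x = c * y x := by
  refine ⟨wronskian z v 0 / wronskian y v 0, fun x hx => ?_⟩
  have hcyclic : wronskian y v x * z x = wronskian z v x * y x + wronskian y z x * v x := by
    simp only [wronskian]
    ring
  rw [hy.wronskian_eq hv hx, hz.wronskian_eq hv hx, hy.wronskian_eq hz hx, hyz] at hcyclic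
  field_simp
  linear_combination hcyclic

end IsSolution

/-- An eigenfunction of `L(q, γ, δ)` for the eigenvalue `μ`. That `-y'' + q y = μ y` is square
integrable need not be required, because `y` is continuous on `[0, π]`. -/
structure IsEigenfunction (q : ℝ → ℝ) (γ δ : ℝ) (μ : ℂ) (y : ℝ → ℂ) : Prop
    extends IsSolution q μ y where
  boundary_left : y 0 * (cos γ : ℂ) + D y 0 * (sin γ : ℂ) = 0
  boundary_right : y π * (cos δ : ℂ) + D y π * (sin δ : ℂ) = 0
  exists_ne_zero : ∃ x ∈ Icc 0 π, y x ≠ 0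

theorem memLp_vol_of_continuousOn {f : ℝ → ℂ} (hf : ContinuousOn f (Icc 0 π))
    {p : ENNReal} : MemLp f p vol := by
  obtain ⟨C, hC⟩ := isCompact_Icc.exists_bound_of_continuousOn hf
  have hfin : IsFiniteMeasure vol := by unfold vol; infer_instance
  refine MemLp.of_bound ((hf.mono Ioo_subset_Icc_self).aestronglyMeasurable measurableSet_Ioo) C ?_
  filter_upwards [ae_vol_mem_Ioo] with x hx using hC x (Ioo_subset_Icc_self hx)

theorem isEigenvalue_iff_exists_isEigenfunction {q : ℝ → ℝ} {γ δ : ℝ} {μ : ℂ} :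
    IsEigenvalue q γ δ μ ↔ ∃ y, IsEigenfunction q γ δ μ y := by
  constructor
  · rintro ⟨y, hdom, hne, heq⟩
    exact ⟨y, ⟨hdom.differentiableOn, hdom.absolutelyContinuous, heq⟩, hdom.boundary_left,
      hdom.boundary_right, hne⟩
  · rintro ⟨y, hy⟩
    refine ⟨y, ⟨hy.differentiableOn, hy.absolutelyContinuous, ?_, hy.boundary_left,
      hy.boundary_right⟩, hy.exists_ne_zero, hy.ae_eq⟩
    exact (memLp_congr_ae hy.ae_eq).2
      (memLp_vol_of_continuousOn (continuousOn_const.mul hy.continuousOn))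

namespace IsEigenfunction

variable {q p : ℝ → ℝ} {γ δ : ℝ} {μ ν : ℂ} {y z v : ℝ → ℂ}

theorem integral_eq_zero (hq : IntervalIntegrable q volume 0 π)
    (hp : IntervalIntegrable p volume 0 π) (hy : IsEigenfunction q γ δ μ y)
    (hz : IsEigenfunction p γ δ ν z) :
    ∫ x in (0 : ℝ)..π, (μ - ν - (q x - p x)) * (y x * z x) = 0 := by
  rw [hy.toIsSolution.integral_eq_wronskian_sub hq hp hz.toIsSolution,
    wronskian_eq_zero_of_boundary hy.boundary_left hz.boundary_left,
    wronskian_eq_zero_of_boundary hy.boundary_right hz.boundary_right, sub_zero]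

theorem conj (hy : IsEigenfunction q γ δ μ y) :
    IsEigenfunction q γ δ (starRingEnd ℂ μ) fun x => starRingEnd ℂ (y x) := by
  have hD : ∀ x ∈ Icc 0 π, D (fun x => starRingEnd ℂ (y x)) x = starRingEnd ℂ (D y x) :=
    fun x hx => D_eq hx (hy.hasDerivWithinAt hx).star
  refine ⟨hy.toIsSolution.conj, ?_, ?_, ?_⟩
  · rw [hD 0 (left_mem_Icc.2 pi_pos.le)]
    simpa only [map_add, map_mul, map_zero, Complex.conj_ofReal] using
      congrArg (starRingEnd ℂ) hy.boundary_left
  · rw [hD π (right_mem_Icc.2 pi_pos.le)]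
    simpa only [map_add, map_mul, map_zero, Complex.conj_ofReal] using
      congrArg (starRingEnd ℂ) hy.boundary_right
  · simpa using hy.exists_ne_zero

theorem im_eq_zero (hq : IntervalIntegrable q volume 0 π)
    (hy : IsEigenfunction q γ δ μ y) : μ.im = 0 := by
  have hnorm : 0 < ∫ x in (0 : ℝ)..π, Complex.normSq (y x) := by
    obtain ⟨x, hx, hyx⟩ := hy.exists_ne_zero
    exact intervalIntegral.integral_pos pi_pos
      (Complex.continuous_normSq.comp_continuousOn hy.continuousOn)
      (fun _ _ => Complex.normSq_nonneg _) ⟨x, hx, Complex.normSq_pos.2 hyx⟩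
  have hint := hy.integral_eq_zero hq hq hy.conj
  simp only [sub_self, sub_zero, Complex.mul_conj, intervalIntegral.integral_const_mul,
    intervalIntegral.integral_ofReal, mul_eq_zero, Complex.ofReal_eq_zero, hnorm.ne', or_false,
    sub_eq_zero] at hint
  exact Complex.conj_eq_iff_im.1 hint.symm

theorem boundary_right_of_boundary_left (hz : IsEigenfunction q γ δ μ z) (hy : IsSolution q μ y)
    (hy_left : y 0 * (cos γ : ℂ) + D y 0 * (sin γ : ℂ) = 0)
    (hv : IsSolution q μ v) (hyv : wronskian y v 0 ≠ 0) :
    y π * (cos δ : ℂ) + D y π * (sin δ : ℂ) = 0 := by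
  have hπ : π ∈ Icc 0 π := right_mem_Icc.2 pi_pos.le
  obtain ⟨c, hc⟩ := hy.exists_eq_const_mul hz.toIsSolution hv
    (wronskian_eq_zero_of_boundary hy_left hz.boundary_left) hyv
  have hc0 : c ≠ 0 := by
    rintro rfl
    obtain ⟨x, hx, hzx⟩ := hz.exists_ne_zero
    exact hzx (by rw [hc x hx, zero_mul])
  have hD : D z π = c * D y π :=
    D_eq hπ (((hy.hasDerivWithinAt hπ).const_mul c).congr hc (hc _ hπ))
  have hz_right := hz.boundary_right
  rw [hc _ hπ, hD] at hz_right
  refine (mul_eq_zero.1 (?_ : c * _ = 0)).resolve_left hc0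
  linear_combination hz_right

end IsEigenfunction

/-- The real number `m` is an eigenvalue of `L(q, γ, δ)` with an eigenfunction that is positive on
`(0, π)`. -/
def HasPositiveEigenfunction (q : ℝ → ℝ) (γ δ m : ℝ) : Prop :=
  ∃ y : ℝ → ℝ, IsEigenfunction q γ δ m (fun x => (y x : ℂ)) ∧ ∀ x ∈ Ioo 0 π, 0 < y x

namespace HasPositiveEigenfunction

variable {q p : ℝ → ℝ} {γ δ m n : ℝ}

theorem not_ae_sub_lt (hq : IntervalIntegrable q volume 0 π)
    (hp : IntervalIntegrable p volume 0 π) (hm : HasPositiveEigenfunction q γ δ m)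
    (hn : HasPositiveEigenfunction p γ δ n) : ¬ ∀ᵐ x ∂vol, q x - p x < m - n := by
  obtain ⟨y, hy, hy_pos⟩ := hm
  obtain ⟨z, hz, hz_pos⟩ := hn
  intro hlt
  have hcont : ContinuousOn (fun x => y x * z x) (uIcc 0 π) := by
    rw [uIcc_of_le pi_pos.le]
    exact (Complex.continuous_re.comp_continuousOn hy.continuousOn).mul
      (Complex.continuous_re.comp_continuousOn hz.continuousOn)
  have hpos : 0 < ∫ x in (0 : ℝ)..π, (m - n - (q x - p x)) * (y x * z x) := by
    refine intervalIntegral_pos_of_ae_pos pi_pos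
      ((intervalIntegrable_const.sub (hq.sub hp)).mul_continuousOn hcont) ?_
    filter_upwards [hlt, ae_vol_mem_Ioo] with x hx hx'
    exact mul_pos (sub_pos.2 hx) (mul_pos (hy_pos x hx') (hz_pos x hx'))
  have hzero := hy.integral_eq_zero hq hp hz
  norm_cast at hzero
  rw [intervalIntegral.integral_ofReal, Complex.ofReal_eq_zero] at hzero
  exact hpos.ne' hzero

theorem not_ae_lt_sub (hq : IntervalIntegrable q volume 0 π)
    (hp : IntervalIntegrable p volume 0 π) (hm : HasPositiveEigenfunction q γ δ m)
    (hn : HasPositiveEigenfunction p γ δ n) : ¬ ∀ᵐ x ∂vol, m - n < q x - p x := fun hlt =>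
  hn.not_ae_sub_lt hp hq hm (hlt.mono fun x hx => by linarith)

theorem le (hq : IntervalIntegrable q volume 0 π) (hm : HasPositiveEigenfunction q γ δ m)
    (hn : HasPositiveEigenfunction q γ δ n) : m ≤ n := by
  by_contra! hlt
  exact hm.not_ae_sub_lt hq hq hn (Eventually.of_forall fun x => by simpa using hlt)

end HasPositiveEigenfunction

theorem lt_of_hasDerivWithinAt_pos_of_eq {f f' : ℝ → ℝ} {a b c : ℝ}
    (hf : ∀ x ∈ Icc a b, HasDerivWithinAt f (f' x) (Icc a b) x) (ha : c ≤ f a)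
    (hpos : ∀ x ∈ Icc a b, f x = c → 0 < f' x) : ∀ x ∈ Ioc a b, c < f x := by
  have hle : ∀ x ∈ Icc a b, c ≤ f x :=
    image_le_of_deriv_right_lt_deriv_boundary' continuousOn_const
      (fun x _ => hasDerivWithinAt_const x _ c) ha (fun x hx => (hf x hx).continuousWithinAt)
      (fun x hx => (hf x (Ico_subset_Icc_self hx)).mono_of_mem_nhdsWithin
        (Icc_mem_nhdsGE_of_mem hx))
      fun x hx hcx => hpos x (Ico_subset_Icc_self hx) hcx.symm
  intro x hx
  refine (hle x (Ioc_subset_Icc_self hx)).lt_of_ne' fun hfx => ?_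
  have hsub : Icc a x ⊆ Icc a b := Icc_subset_Icc_right hx.2
  have hmin : IsLocalMinOn f (Icc a x) x :=
    (show IsMinOn f (Icc a x) x from fun t ht => hfx.trans_le (hle t (hsub ht))).localize
  have hcone : a - x ∈ posTangentConeAt (Icc a x) x :=
    sub_mem_posTangentConeAt_of_segment_subset (by rw [segment_symm, segment_eq_Icc hx.1.le])
  have hslope := hmin.hasFDerivWithinAt_nonneg
    ((hf x (Ioc_subset_Icc_self hx)).mono hsub).hasFDerivWithinAt hcone
  have hderiv := hpos x (Ioc_subset_Icc_self hx) hfx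
  simp only [ContinuousLinearMap.toSpanSingleton_apply, smul_eq_mul] at hslope
  nlinarith [hx.1]

/-- The right-hand side of the equation `θ' = pruferRate Q l θ` satisfied by the angle `θ` of the
phase-plane curve `(y, u) = (r sin θ, r cos θ)`, where `y' = Q y + u` and
`u' = -(l + Q ^ 2) y - Q u`. -/
noncomputable def pruferRate (Q l θ : ℝ) : ℝ := (cos θ + Q * sin θ) ^ 2 + l * sin θ ^ 2

section PruferRate

variable {Q l M θ φ : ℝ}

theorem abs_cos_add_mul_sin_le (hQ : |Q| ≤ M) : |cos θ + Q * sin θ| ≤ 1 + M := by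
  have hM : 0 ≤ M := (abs_nonneg Q).trans hQ
  calc |cos θ + Q * sin θ| ≤ |cos θ| + |Q| * |sin θ| := by
        rw [← abs_mul]; exact abs_add_le _ _
    _ ≤ 1 + M * 1 := by gcongr; exacts [abs_cos_le_one θ, abs_sin_le_one θ]
    _ = 1 + M := by rw [mul_one]

theorem pruferRate_le (hQ : |Q| ≤ M) : pruferRate Q l θ ≤ (1 + M) ^ 2 + l * sin θ ^ 2 := by
  have hsq := sq_le_sq' (abs_le.1 (abs_cos_add_mul_sin_le (θ := θ) hQ)).1
    (abs_le.1 (abs_cos_add_mul_sin_le hQ)).2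
  exact add_le_add_left hsq _

theorem abs_pruferRate_le (hQ : |Q| ≤ M) : |pruferRate Q l θ| ≤ (1 + M) ^ 2 + |l| := by
  refine (abs_add_le _ _).trans (add_le_add ?_ ?_)
  · rw [abs_pow]
    gcongr
    exact abs_cos_add_mul_sin_le hQ
  · rw [abs_mul, abs_of_nonneg (sq_nonneg (sin θ))]
    exact mul_le_of_le_one_right (abs_nonneg l) (sin_sq_le_one θ)

theorem abs_pruferRate_sub_le (hQ : |Q| ≤ M) :
    |pruferRate Q l θ - pruferRate Q l φ| ≤ 2 * ((1 + M) ^ 2 + |l|) * |θ - φ| := by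
  have hM : 0 ≤ M := (abs_nonneg Q).trans hQ
  set A := cos θ + Q * sin θ
  set B := cos φ + Q * sin φ
  have hAB : |A - B| ≤ (1 + M) * |θ - φ| :=
    calc |A - B| = |(cos θ - cos φ) + Q * (sin θ - sin φ)| := by congr 1; ring
      _ ≤ |cos θ - cos φ| + |Q| * |sin θ - sin φ| := by rw [← abs_mul]; exact abs_add_le _ _
      _ ≤ |θ - φ| + M * |θ - φ| := by
        have hcos := abs_cos_sub_cos_le θ φ
        have hsin := abs_sin_sub_sin_le θ φ
        gcongr
      _ = (1 + M) * |θ - φ| := by ring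
  have hAB' : |A + B| ≤ 2 * (1 + M) := (abs_add_le _ _).trans
    ((add_le_add (abs_cos_add_mul_sin_le hQ) (abs_cos_add_mul_sin_le hQ)).trans_eq (by ring))
  have hsin : |sin θ + sin φ| ≤ 2 := (abs_add_le _ _).trans
    ((add_le_add (abs_sin_le_one θ) (abs_sin_le_one φ)).trans_eq (by norm_num))
  calc |pruferRate Q l θ - pruferRate Q l φ|
      = |(A - B) * (A + B) + l * ((sin θ - sin φ) * (sin θ + sin φ))| := by
        congr 1; simp only [pruferRate]; ring
    _ ≤ |A - B| * |A + B| + |l| * (|sin θ - sin φ| * |sin θ + sin φ|) := by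
        rw [← abs_mul, ← abs_mul, ← abs_mul]; exact abs_add_le _ _
    _ ≤ (1 + M) * |θ - φ| * (2 * (1 + M)) + |l| * (|θ - φ| * 2) := by
        have hsub := abs_sin_sub_sin_le θ φ
        gcongr
    _ = 2 * ((1 + M) ^ 2 + |l|) * |θ - φ| := by ring

theorem lipschitzWith_pruferRate (hQ : |Q| ≤ M) :
    LipschitzWith (2 * ((1 + M) ^ 2 + |l|)).toNNReal (pruferRate Q l) :=
  LipschitzWith.of_dist_le' fun θ φ => by
    simpa only [Real.dist_eq] using abs_pruferRate_sub_le hQ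

theorem abs_pruferRate_sub_pruferRate_le (k : ℝ) :
    |pruferRate Q k θ - pruferRate Q l θ| ≤ |k - l| := by
  rw [show pruferRate Q k θ - pruferRate Q l θ = (k - l) * sin θ ^ 2 by
    simp only [pruferRate]; ring, abs_mul, abs_of_nonneg (sq_nonneg (sin θ))]
  exact mul_le_of_le_one_right (abs_nonneg _) (sin_sq_le_one θ)

theorem pruferRate_int_mul_pi (n : ℤ) : pruferRate Q l (n * π) = 1 := by
  simp [pruferRate, sin_int_mul_pi, cos_sq']

theorem one_le_pruferRate_mul (hQ : |Q| ≤ M) (hl : 2 + 3 * M ^ 2 ≤ l) :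
    1 ≤ pruferRate Q l θ * (1 + cos (2 * θ) / 2) := by
  have hQM : Q ^ 2 ≤ M ^ 2 := sq_le_sq' (abs_le.1 hQ).1 (abs_le.1 hQ).2
  have hsc := sin_sq_add_cos_sq θ
  have hrate : 3 / 4 * cos θ ^ 2 + 2 * sin θ ^ 2 ≤ pruferRate Q l θ := by
    rw [pruferRate]
    nlinarith [sq_nonneg (cos θ / 2 + 2 * (Q * sin θ)), sq_nonneg (sin θ)]
  have hfactor : 1 + cos (2 * θ) / 2 = 3 / 2 * cos θ ^ 2 + 1 / 2 * sin θ ^ 2 := by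
    rw [cos_two_mul]
    linear_combination -hsc / 2
  rw [hfactor]
  calc 1 = (sin θ ^ 2 + cos θ ^ 2) ^ 2 := by rw [hsc, one_pow]
    _ ≤ (3 / 4 * cos θ ^ 2 + 2 * sin θ ^ 2) * (3 / 2 * cos θ ^ 2 + 1 / 2 * sin θ ^ 2) := by
        nlinarith [mul_nonneg (sq_nonneg (sin θ)) (sq_nonneg (cos θ)), sq_nonneg (cos θ ^ 2)]
    _ ≤ _ := by gcongr

end PruferRate

/-- `θ` is a Prüfer angle on `[a, b]` of the system `y' = Q y + u`, `u' = -(l + Q ^ 2) y - Q u`.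
For a primitive `Q` of `q` this system is `-y'' + q y = l y`, written with the quasi-derivative
`u = y' - Q y`, so that an integrable `q` still gives continuous coefficients. -/
def IsPruferAngle (Q : ℝ → ℝ) (l a b : ℝ) (θ : ℝ → ℝ) : Prop :=
  ∀ x ∈ Icc a b, HasDerivWithinAt θ (pruferRate (Q x) l (θ x)) (Icc a b) x

theorem exists_isPruferAngle {Q : ℝ → ℝ} {a b : ℝ} (hab : a ≤ b) (hQ : ContinuousOn Q (Icc a b))
    (l α : ℝ) : ∃ θ, IsPruferAngle Q l a b θ ∧ θ a = α := by
  obtain ⟨M, hM⟩ := isCompact_Icc.exists_bound_of_continuousOn hQ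
  set C : ℝ := (1 + M) ^ 2 + |l|
  have hC0 : 0 ≤ C := by positivity
  have hpl : IsPicardLindelof (fun x => pruferRate (Q x) l) (⟨a, left_mem_Icc.2 hab⟩ : Icc a b) α
      (C.toNNReal * (b - a).toNNReal) 0 C.toNNReal (2 * C).toNNReal := by
    refine ⟨fun x hx => (lipschitzWith_pruferRate (hM x hx)).lipschitzOnWith, fun θ _ => ?_,
      fun x hx θ _ => ?_, ?_⟩
    · simp only [pruferRate]
      fun_prop
    · rw [Real.coe_toNNReal C hC0]
      exact abs_pruferRate_le (hM x hx)
    · simp [hab]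
  obtain ⟨θ, hθa, hθ⟩ := hpl.exists_eq_forall_mem_Icc_hasDerivWithinAt₀
  exact ⟨θ, hθ, hθa⟩

namespace IsPruferAngle

variable {Q : ℝ → ℝ} {l k a b α β : ℝ} {θ φ : ℝ → ℝ}

theorem continuousOn (hθ : IsPruferAngle Q l a b θ) : ContinuousOn θ (Icc a b) :=
  fun x hx => (hθ x hx).continuousWithinAt

theorem hasDerivWithinAt_Ici (hθ : IsPruferAngle Q l a b θ) {x : ℝ} (hx : x ∈ Ico a b) :
    HasDerivWithinAt θ (pruferRate (Q x) l (θ x)) (Ici x) x :=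
  (hθ x (Ico_subset_Icc_self hx)).mono_of_mem_nhdsWithin (Icc_mem_nhdsGE_of_mem hx)

theorem dist_le (hab : a ≤ b) {M : ℝ} (hQ : ∀ x ∈ Icc a b, |Q x| ≤ M)
    (hθ : IsPruferAngle Q k a b θ) (hφ : IsPruferAngle Q l a b φ) (ha : θ a = φ a) :
    dist (θ b) (φ b) ≤
      gronwallBound 0 (2 * ((1 + M) ^ 2 + |l|)).toNNReal |k - l| (b - a) := by
  have hbound := dist_le_of_approx_trajectories_ODE_of_mem (s := fun _ => univ) (δ := 0)
    (v := fun x => pruferRate (Q x) l) (εf := |k - l|) (εg := 0)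
    (fun x hx => (lipschitzWith_pruferRate (hQ x (Ico_subset_Icc_self hx))).lipschitzOnWith)
    hθ.continuousOn (fun x hx => hθ.hasDerivWithinAt_Ici hx)
    (fun x _ => abs_pruferRate_sub_pruferRate_le k) (fun x _ => mem_univ _)
    hφ.continuousOn (fun x hx => hφ.hasDerivWithinAt_Ici hx)
    (fun x _ => (dist_self _).le) (fun x _ => mem_univ _) (by rw [ha, dist_self])
    b (right_mem_Icc.2 hab)
  rwa [add_zero] at hbound

theorem continuous_right_endpoint (hab : a ≤ b) (hQ : ContinuousOn Q (Icc a b))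
    {Θ : ℝ → ℝ → ℝ} (hΘ : ∀ l, IsPruferAngle Q l a b (Θ l)) (ha : ∀ l, Θ l a = α) :
    Continuous fun l => Θ l b := by
  obtain ⟨M, hM⟩ := isCompact_Icc.exists_bound_of_continuousOn hQ
  refine continuous_iff_continuousAt.2 fun l => tendsto_iff_dist_tendsto_zero.2 ?_
  refine squeeze_zero (fun _ => dist_nonneg)
    (fun k => dist_le hab hM (hΘ k) (hΘ l) ((ha k).trans (ha l).symm)) ?_
  have hcont : Continuous fun k => gronwallBound 0 (2 * ((1 + M) ^ 2 + |l|)).toNNReal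
      |k - l| (b - a) :=
    (gronwallBound_continuous_ε _ _ _).comp (continuous_id.sub continuous_const).abs
  simpa [gronwallBound_ε0_δ0] using hcont.tendsto l

theorem int_mul_pi_lt (hθ : IsPruferAngle Q l a b θ) {n : ℤ} (ha : n * π ≤ θ a) :
    ∀ x ∈ Ioc a b, n * π < θ x :=
  lt_of_hasDerivWithinAt_pos_of_eq hθ ha fun x _ hx => by
    rw [hx, pruferRate_int_mul_pi]; exact one_pos

theorem mem_Ioo (hθ : IsPruferAngle Q l a b θ) (ha : 0 ≤ θ a) (hb : θ b ≤ π) :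
    ∀ x ∈ Ioo a b, θ x ∈ Ioo 0 π := by
  refine fun x hx => ⟨?_, ?_⟩
  · simpa using hθ.int_mul_pi_lt (n := 0) (by simpa using ha) x (Ioo_subset_Ioc_self hx)
  · by_contra! hle
    have hsub : Icc x b ⊆ Icc a b := Icc_subset_Icc_left hx.1.le
    have hθ' : IsPruferAngle Q l x b θ := fun t ht => (hθ t (hsub ht)).mono hsub
    have hlt := hθ'.int_mul_pi_lt (n := 1) (by simpa using hle) b (right_mem_Ioc.2 hx.2)
    exact hb.not_gt (by simpa using hlt)

theorem pi_le (hθ : IsPruferAngle Q l a b θ) {M : ℝ} (hQ : ∀ x ∈ Icc a b, |Q x| ≤ M)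
    (hl : 2 + 3 * M ^ 2 ≤ l) (hab : π ≤ b - a) (ha : 0 ≤ θ a) : π ≤ θ b := by
  -- The correction `sin (2 θ) / 4` turns the lower bound `3/4 cos² θ + 2 sin² θ` for the rate,
  -- whose minimum `3/4` is too small, into a lower bound `1`.
  set g : ℝ → ℝ := fun t => t + sin (2 * t) / 4 with hg
  have hgd : ∀ t, HasDerivAt g (1 + cos (2 * t) / 2) t := fun t =>
    ((hasDerivAt_id t).add ((((hasDerivAt_id t).const_mul 2).sin).div_const 4)).congr_deriv
      (by simp only [id_eq]; ring)
  have hg_mono : StrictMono g := strictMono_of_hasDerivAt_pos hgd fun t => by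
    linarith [neg_one_le_cos (2 * t)]
  have hmono : MonotoneOn (fun x => g (θ x) - x) (Icc a b) := by
    have hd : ∀ x ∈ Icc a b, HasDerivWithinAt (fun x => g (θ x) - x)
        ((1 + cos (2 * θ x) / 2) * pruferRate (Q x) l (θ x) - 1) (Icc a b) x := fun x hx =>
      ((hgd (θ x)).comp_hasDerivWithinAt x (hθ x hx)).sub (hasDerivWithinAt_id x _)
    refine monotoneOn_of_hasDerivWithinAt_nonneg (convex_Icc a b)
      (fun x hx => (hd x hx).continuousWithinAt)
      (fun x hx => (hd x (interior_subset hx)).mono interior_subset) fun x hx => ?_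
    rw [sub_nonneg, mul_comm]
    exact one_le_pruferRate_mul (hQ x (interior_subset hx)) hl
  have hab' : a ≤ b := by linarith [pi_pos]
  have hincr := hmono (left_mem_Icc.2 hab') (right_mem_Icc.2 hab') hab'
  have hga : g 0 ≤ g (θ a) := hg_mono.monotone ha
  have hg0 : g 0 = 0 := by simp [hg]
  have hgπ : g π = π := by simp [hg]
  rw [← hg_mono.le_iff_le, hgπ]
  dsimp only at hincr
  linarith

theorem exists_forall_right_le_of_left_le (hab : a < b) (hQ : ContinuousOn Q (Icc a b))
    (hβ : 0 < β) (hβα : β ≤ α) (hα : α < π) :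
    ∃ l₀, ∀ l ≤ l₀, ∀ θ, IsPruferAngle Q l a b θ → θ a ≤ α → θ b ≤ β := by
  obtain ⟨M, hM⟩ := isCompact_Icc.exists_bound_of_continuousOn hQ
  have hab' : 0 < b - a := sub_pos.2 hab
  -- The barrier is a line from `α` to `β`, along which `sin ≥ s > 0`, so that the rate tends to
  -- `-∞` uniformly as `l → -∞`.
  set c : ℝ := (β - α) / (b - a)
  have hcb : c * (b - a) = β - α := div_mul_cancel₀ _ hab'.ne'
  have hline : ∀ x ∈ Icc a b, α + c * (x - a) ∈ Icc β α := fun x hx => by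
    have hc0 : c ≤ 0 := div_nonpos_of_nonpos_of_nonneg (by linarith) hab'.le
    have hleft : c * (x - a) ≤ 0 := mul_nonpos_of_nonpos_of_nonneg hc0 (sub_nonneg.2 hx.1)
    have hright : c * (b - x) ≤ 0 := mul_nonpos_of_nonpos_of_nonneg hc0 (sub_nonneg.2 hx.2)
    constructor <;> linarith
  set s : ℝ := min (sin β) (sin α)
  have hs : 0 < s := lt_min (sin_pos_of_pos_of_lt_pi hβ (hβα.trans_lt hα))
    (sin_pos_of_pos_of_lt_pi (hβ.trans_le hβα) hα)
  have hsin : ∀ x ∈ Icc a b, s ≤ sin (α + c * (x - a)) := fun x hx =>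
    strictConcaveOn_sin_Icc.concaveOn.min_le_of_mem_Icc ⟨hβ.le, (hβα.trans_lt hα).le⟩
      ⟨(hβ.trans_le hβα).le, hα.le⟩ (hline x hx)
  refine ⟨min 0 ((c - (1 + M) ^ 2 - 1) / s ^ 2), fun l hl θ hθ ha => ?_⟩
  have hl0 : l ≤ 0 := hl.trans (min_le_left _ _)
  have hls : l * s ^ 2 ≤ c - (1 + M) ^ 2 - 1 :=
    (le_div_iff₀ (by positivity)).1 (hl.trans (min_le_right _ _))
  have hrate : ∀ x ∈ Icc a b, θ x = α + c * (x - a) → pruferRate (Q x) l (θ x) < c :=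
    fun x hx hθx => by
      have hsq : s ^ 2 ≤ sin (θ x) ^ 2 := pow_le_pow_left₀ hs.le (hθx ▸ hsin x hx) 2
      linarith [pruferRate_le (l := l) (θ := θ x) (hM x hx), mul_le_mul_of_nonpos_left hsq hl0]
  have hbarrier := image_le_of_deriv_right_lt_deriv_boundary hθ.continuousOn
    (fun x hx => hθ.hasDerivWithinAt_Ici hx) (B := fun x => α + c * (x - a)) (B' := fun _ => c)
    (by simpa using ha)
    (fun x => ((((hasDerivAt_id x).sub_const a).const_mul c).const_add α).congr_deriv (mul_one c))
    (fun x hx => hrate x (Ico_subset_Icc_self hx)) (right_mem_Icc.2 hab.le)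
  simpa only [hcb, add_sub_cancel] using hbarrier

theorem exists_forall_right_le (hab : a < b) (hQ : ContinuousOn Q (Icc a b)) (hα : α < π)
    (hβ : 0 < β) : ∃ l₀, ∀ l ≤ l₀, ∀ θ, IsPruferAngle Q l a b θ → θ a = α → θ b ≤ β := by
  obtain ⟨l₀, hl₀⟩ := exists_forall_right_le_of_left_le hab hQ
    (lt_min hβ pi_div_two_pos) ((min_le_right β _).trans (le_max_right α _))
    (max_lt hα (half_lt_self pi_pos))
  exact ⟨l₀, fun l hl θ hθ ha =>
    (hl₀ l hl θ hθ (ha.trans_le (le_max_left _ _))).trans (min_le_left _ _)⟩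

theorem exists_le_right_eq (hab : a < b) (hQ : ContinuousOn Q (Icc a b)) (hα : α < π)
    (hβ : 0 < β) (hθ : IsPruferAngle Q l a b θ) (ha : θ a = α) (hb : β ≤ θ b) :
    ∃ m ≤ l, ∃ φ, IsPruferAngle Q m a b φ ∧ φ a = α ∧ φ b = β := by
  obtain ⟨l₀, hl₀⟩ := exists_forall_right_le hab hQ hα hβ
  have hexists : ∀ k, ∃ φ, IsPruferAngle Q k a b φ ∧ φ a = α ∧ (k = l → φ = θ) := fun k => by
    rcases eq_or_ne k l with rfl | hk
    · exact ⟨θ, hθ, ha, fun _ => rfl⟩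
    · obtain ⟨φ, hφ, hφa⟩ := exists_isPruferAngle hab.le hQ k α
      exact ⟨φ, hφ, hφa, fun h => absurd h hk⟩
  choose Θ hΘ hΘa hΘl using hexists
  have hlow : Θ (min l l₀) b ≤ β := hl₀ _ (min_le_right _ _) _ (hΘ _) (hΘa _)
  obtain ⟨m, hm, hmβ⟩ := intermediate_value_Icc (min_le_left l l₀)
    (continuous_right_endpoint hab.le hQ hΘ hΘa).continuousOn
    ⟨hlow, hb.trans_eq (by rw [hΘl l rfl])⟩
  exact ⟨m, hm.2, Θ m, hΘ m, hΘa m, hmβ⟩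

theorem exists_amplitude (hQ : ContinuousOn Q (Icc a b)) (hθ : IsPruferAngle Q l a b θ) :
    ∃ r : ℝ → ℝ, (∀ x, 0 < r x) ∧ ∀ x ∈ Icc a b,
      HasDerivWithinAt (fun x => r x * sin (θ x))
        (r x * (Q x * sin (θ x) + cos (θ x))) (Icc a b) x ∧
      HasDerivWithinAt (fun x => r x * cos (θ x))
        (-(l + Q x ^ 2) * (r x * sin (θ x)) - Q x * (r x * cos (θ x))) (Icc a b) x := by
  set ρ : ℝ → ℝ := fun x => sin (θ x) * (Q x * sin (θ x) + cos (θ x)) -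
    cos (θ x) * ((l + Q x ^ 2) * sin (θ x) + Q x * cos (θ x)) with hρ
  have hρc : ContinuousOn ρ (Icc a b) := by
    have hθc := hθ.continuousOn
    fun_prop
  have hlog : ∀ x ∈ Icc a b,
      HasDerivWithinAt (fun x => ∫ t in a..x, ρ t) (ρ x) (Icc a b) x := fun x hx => by
    have hfact : Fact (x ∈ Icc a b) := ⟨hx⟩
    exact intervalIntegral.integral_hasDerivWithinAt_right
      ((hρc.mono (Icc_subset_Icc_right hx.2)).intervalIntegrable_of_Icc hx.1)
      (hρc.stronglyMeasurableAtFilter_nhdsWithin measurableSet_Icc x) (hρc x hx)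
  refine ⟨fun x => exp (∫ t in a..x, ρ t), fun x => exp_pos _, fun x hx => ?_⟩
  have hsc := sin_sq_add_cos_sq (θ x)
  refine ⟨((hlog x hx).exp.mul (hθ x hx).sin).congr_deriv ?_,
    ((hlog x hx).exp.mul (hθ x hx).cos).congr_deriv ?_⟩
  · simp only [hρ, pruferRate]
    linear_combination exp (∫ t in a..x, ρ t) * (Q x * sin (θ x) + cos (θ x)) * hsc
  · simp only [hρ, pruferRate]
    linear_combination (-exp (∫ t in a..x, ρ t)) *
      ((l + Q x ^ 2) * sin (θ x) + Q x * cos (θ x)) * hsc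

end IsPruferAngle

section CenteredPrimitive

variable {q : ℝ → ℝ}

/-- The primitive on `[0, π]` of `q` minus its mean. Subtracting the mean makes it vanish at both
endpoints, so that `y' - Q y` has the boundary values of `y'`. -/
noncomputable def centeredPrimitive (q : ℝ → ℝ) (x : ℝ) : ℝ :=
  ∫ t in (0 : ℝ)..x, (q t - ⨍ s in (0 : ℝ)..π, q s)

theorem centeredPrimitive_zero : centeredPrimitive q 0 = 0 :=
  intervalIntegral.integral_same

theorem centeredPrimitive_pi (hq : IntervalIntegrable q volume 0 π) :
    centeredPrimitive q π = 0 := by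
  rw [centeredPrimitive, intervalIntegral.integral_sub hq intervalIntegrable_const,
    intervalIntegral.integral_const, interval_average_eq_div, sub_zero, smul_eq_mul,
    mul_div_cancel₀ _ pi_ne_zero, sub_self]

theorem absolutelyContinuous_centeredPrimitive (hq : IntervalIntegrable q volume 0 π) :
    AbsolutelyContinuousOnInterval (centeredPrimitive q) 0 π :=
  absolutelyContinuousOnInterval_integral (hq.sub intervalIntegrable_const)

theorem continuousOn_centeredPrimitive (hq : IntervalIntegrable q volume 0 π) :
    ContinuousOn (centeredPrimitive q) (Icc 0 π) :=
  uIcc_of_le pi_pos.le ▸ (absolutelyContinuous_centeredPrimitive hq).continuousOn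

theorem ae_hasDerivAt_centeredPrimitive (hq : IntervalIntegrable q volume 0 π) :
    ∀ᵐ x ∂vol, HasDerivAt (centeredPrimitive q) (q x - ⨍ s in (0 : ℝ)..π, q s) x :=
  ae_vol_iff.2 <| (hq.sub intervalIntegrable_const).ae_hasDerivAt_integral.mono
    fun _ hx hx' => hx hx' 0 left_mem_uIcc

end CenteredPrimitive

theorem IsSolution.ofReal {q y v : ℝ → ℝ} {m : ℝ}
    (hy : ∀ x ∈ Icc 0 π, HasDerivWithinAt y (v x) (Icc 0 π) x)
    (hv : AbsolutelyContinuousOnInterval v 0 π)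
    (hv' : ∀ᵐ x ∂vol, HasDerivAt v ((q x - m) * y x) x) :
    IsSolution q m fun x => (y x : ℂ) := by
  refine .of_hasDerivAt (v := fun x => (v x : ℂ)) (fun x hx => (hy x hx).ofReal_comp) ?_ ?_
  · exact absolutelyContinuousOnInterval_of_dist_le hv fun s _ t _ =>
      (Complex.isometry_ofReal.dist_eq _ _).le
  · filter_upwards [hv'] with x hx
    exact hx.ofReal_comp.congr_deriv (by push_cast; rfl)

theorem IsSolution.of_quasiDerivative {q Q y u : ℝ → ℝ} {l κ : ℝ}
    (hQ : AbsolutelyContinuousOnInterval Q 0 π) (hQ' : ∀ᵐ x ∂vol, HasDerivAt Q (q x - κ) x)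
    (hy : ∀ x ∈ Icc 0 π, HasDerivWithinAt y (Q x * y x + u x) (Icc 0 π) x)
    (hu : ∀ x ∈ Icc 0 π,
      HasDerivWithinAt u (-(l + Q x ^ 2) * y x - Q x * u x) (Icc 0 π) x) :
    IsSolution q (l + κ : ℝ) fun x => (y x : ℂ) := by
  have hQc : ContinuousOn Q (Icc 0 π) := uIcc_of_le pi_pos.le ▸ hQ.continuousOn
  have hyc : ContinuousOn y (Icc 0 π) := fun x hx => (hy x hx).continuousWithinAt
  have huc : ContinuousOn u (Icc 0 π) := fun x hx => (hu x hx).continuousWithinAt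
  have hy_ac := absolutelyContinuousOnInterval_of_hasDerivWithinAt pi_pos.le hy (by fun_prop)
  have hu_ac := absolutelyContinuousOnInterval_of_hasDerivWithinAt pi_pos.le hu (by fun_prop)
  refine .ofReal hy ((hQ.fun_mul hy_ac).fun_add hu_ac) ?_
  filter_upwards [hQ', ae_vol_mem_Ioo] with x hQx hx
  have hnhds := Icc_mem_nhds hx.1 hx.2
  have hx' := Ioo_subset_Icc_self hx
  exact ((hQx.mul ((hy x hx').hasDerivAt hnhds)).add ((hu x hx').hasDerivAt hnhds)).congr_deriv
    (by ring)

theorem boundary_iff_sin_add_eq_zero {r θ γ : ℝ} (hr : 0 < r) :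
    ((r * sin θ : ℝ) : ℂ) * (cos γ : ℂ) + ((r * cos θ : ℝ) : ℂ) * (sin γ : ℂ) = 0 ↔
      sin (θ + γ) = 0 := by
  have hadd : r * sin θ * cos γ + r * cos θ * sin γ = r * sin (θ + γ) := by
    rw [sin_add]; ring
  norm_cast
  rw [hadd, mul_eq_zero, or_iff_right hr.ne']

namespace IsPruferAngle

variable {q θ : ℝ → ℝ} {l : ℝ}

theorem exists_isSolution (hq : IntervalIntegrable q volume 0 π)
    (hθ : IsPruferAngle (centeredPrimitive q) l 0 π θ) :
    ∃ r : ℝ → ℝ, (∀ x, 0 < r x) ∧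
      IsSolution q (l + ⨍ s in (0 : ℝ)..π, q s : ℝ) (fun x => ((r x * sin (θ x) : ℝ) : ℂ)) ∧
      D (fun x => ((r x * sin (θ x) : ℝ) : ℂ)) 0 = (r 0 * cos (θ 0) : ℝ) ∧
      D (fun x => ((r x * sin (θ x) : ℝ) : ℂ)) π = (r π * cos (θ π) : ℝ) := by
  obtain ⟨r, hr, hderiv⟩ := hθ.exists_amplitude (continuousOn_centeredPrimitive hq)
  have h0 : (0 : ℝ) ∈ Icc 0 π := left_mem_Icc.2 pi_pos.le
  have hπ : π ∈ Icc 0 π := right_mem_Icc.2 pi_pos.le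
  refine ⟨r, hr, .of_quasiDerivative (absolutelyContinuous_centeredPrimitive hq)
    (ae_hasDerivAt_centeredPrimitive hq) (fun x hx => (hderiv x hx).1.congr_deriv (by ring))
    (fun x hx => (hderiv x hx).2), ?_, ?_⟩
  · rw [D_eq h0 (hderiv 0 h0).1.ofReal_comp, centeredPrimitive_zero, zero_mul, zero_add]
  · rw [D_eq hπ (hderiv π hπ).1.ofReal_comp, centeredPrimitive_pi hq, zero_mul, zero_add]

theorem hasPositiveEigenfunction (hq : IntervalIntegrable q volume 0 π) {γ δ : ℝ}
    (hθ : IsPruferAngle (centeredPrimitive q) l 0 π θ) (h0 : 0 ≤ θ 0) (hπ : θ π ≤ π)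
    (hγ : sin (θ 0 + γ) = 0) (hδ : sin (θ π + δ) = 0) :
    HasPositiveEigenfunction q γ δ (l + ⨍ s in (0 : ℝ)..π, q s) := by
  obtain ⟨r, hr, hy, hD0, hDπ⟩ := hθ.exists_isSolution hq
  have hpos : ∀ x ∈ Ioo 0 π, 0 < r x * sin (θ x) := fun x hx =>
    mul_pos (hr x) (sin_pos_of_mem_Ioo (hθ.mem_Ioo h0 hπ x hx))
  refine ⟨fun x => r x * sin (θ x), ⟨hy, ?_, ?_, π / 2, ?_, ?_⟩, hpos⟩
  · rw [hD0, boundary_iff_sin_add_eq_zero (hr 0), hγ]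
  · rw [hDπ, boundary_iff_sin_add_eq_zero (hr π), hδ]
  · exact ⟨by positivity, half_le_self pi_pos.le⟩
  · exact Complex.ofReal_ne_zero.2 (hpos _ ⟨by positivity, half_lt_self pi_pos⟩).ne'

theorem sin_right_add_eq_zero (hq : IntervalIntegrable q volume 0 π) {γ δ : ℝ}
    (hθ : IsPruferAngle (centeredPrimitive q) l 0 π θ) (hγ : sin (θ 0 + γ) = 0)
    (hl : IsEigenvalue q γ δ (l + ⨍ s in (0 : ℝ)..π, q s : ℝ)) : sin (θ π + δ) = 0 := by
  obtain ⟨z, hz⟩ := isEigenvalue_iff_exists_isEigenfunction.1 hl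
  obtain ⟨φ, hφ, hφ0⟩ := exists_isPruferAngle pi_pos.le (continuousOn_centeredPrimitive hq) l
    (θ 0 + π / 2)
  obtain ⟨r, hr, hy, hD0, hDπ⟩ := hθ.exists_isSolution hq
  obtain ⟨s, hs, hv, hvD0, -⟩ := hφ.exists_isSolution hq
  have hwronskian : wronskian (fun x => ((r x * sin (θ x) : ℝ) : ℂ))
      (fun x => ((s x * sin (φ x) : ℝ) : ℂ)) 0 = (-(r 0 * s 0) : ℝ) := by
    have hsc := sin_sq_add_cos_sq (θ 0)
    rw [wronskian, hD0, hvD0, hφ0, sin_add_pi_div_two, cos_add_pi_div_two]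
    norm_cast
    linear_combination (-(r 0 * s 0)) * hsc
  rw [← boundary_iff_sin_add_eq_zero (hr π), ← hDπ]
  refine hz.boundary_right_of_boundary_left hy ?_ hv ?_
  · rw [hD0, boundary_iff_sin_add_eq_zero (hr 0), hγ]
  · rw [hwronskian]
    exact Complex.ofReal_ne_zero.2 (neg_ne_zero.2 (mul_pos (hr 0) (hs 0)).ne')

end IsPruferAngle

theorem exists_mem_Ico_sin_add_eq_zero (γ : ℝ) : ∃ α ∈ Ico 0 π, sin (α + γ) = 0 := by
  refine ⟨toIcoMod pi_pos 0 (-γ), toIcoMod_mem_Ico' pi_pos _, sin_eq_zero_iff.2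
    ⟨-toIcoDiv pi_pos 0 (-γ), ?_⟩⟩
  have hdecomp := toIcoMod_add_toIcoDiv_zsmul pi_pos 0 (-γ)
  rw [zsmul_eq_mul] at hdecomp
  push_cast
  linear_combination -hdecomp

theorem exists_mem_Ioc_sin_add_eq_zero (δ : ℝ) : ∃ β ∈ Ioc 0 π, sin (β + δ) = 0 := by
  obtain ⟨α, hα, hsin⟩ := exists_mem_Ico_sin_add_eq_zero (-δ)
  refine ⟨π - α, ⟨sub_pos.2 hα.2, sub_le_self _ hα.1⟩, ?_⟩
  rw [show π - α + δ = π - (α + -δ) by ring, sin_pi_sub, hsin]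

theorem le_of_sin_add_eq_zero {β δ t : ℝ} (hβ : β ≤ π) (hβδ : sin (β + δ) = 0) (ht : 0 < t)
    (htδ : sin (t + δ) = 0) : β ≤ t := by
  obtain ⟨j, hj⟩ := sin_eq_zero_iff.1 hβδ
  obtain ⟨k, hk⟩ := sin_eq_zero_iff.1 htδ
  have hlt : (j - 1 : ℝ) < k := by
    refine lt_of_mul_lt_mul_right ?_ pi_pos.le
    linarith
  have hjk : (j : ℝ) ≤ k := by exact_mod_cast Int.sub_one_lt_iff.1 (by exact_mod_cast hlt)
  linarith [mul_le_mul_of_nonneg_right hjk pi_pos.le]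

theorem exists_hasPositiveEigenfunction {q : ℝ → ℝ} (hq : IntervalIntegrable q volume 0 π)
    (γ δ : ℝ) : ∃ m, HasPositiveEigenfunction q γ δ m := by
  obtain ⟨α, hα, hαγ⟩ := exists_mem_Ico_sin_add_eq_zero γ
  obtain ⟨β, hβ, hβδ⟩ := exists_mem_Ioc_sin_add_eq_zero δ
  have hQ := continuousOn_centeredPrimitive hq
  obtain ⟨M, hM⟩ := isCompact_Icc.exists_bound_of_continuousOn hQ
  obtain ⟨θ, hθ, rfl⟩ := exists_isPruferAngle pi_pos.le hQ (2 + 3 * M ^ 2) α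
  have hπ : π ≤ θ π := hθ.pi_le hM le_rfl (sub_zero π).ge hα.1
  obtain ⟨k, -, φ, hφ, hφ0, rfl⟩ :=
    hθ.exists_le_right_eq pi_pos hQ hα.2 hβ.1 rfl (hβ.2.trans hπ)
  exact ⟨_, hφ.hasPositiveEigenfunction hq (hφ0 ▸ hα.1) hβ.2 (hφ0 ▸ hαγ) hβδ⟩

theorem exists_hasPositiveEigenfunction_le {q : ℝ → ℝ} {γ δ m : ℝ}
    (hq : IntervalIntegrable q volume 0 π) (hm : IsEigenvalue q γ δ m) :
    ∃ n ≤ m, HasPositiveEigenfunction q γ δ n := by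
  obtain ⟨α, hα, hαγ⟩ := exists_mem_Ico_sin_add_eq_zero γ
  obtain ⟨β, hβ, hβδ⟩ := exists_mem_Ioc_sin_add_eq_zero δ
  have hQ := continuousOn_centeredPrimitive hq
  obtain ⟨θ, hθ, rfl⟩ := exists_isPruferAngle pi_pos.le hQ (m - ⨍ s in (0 : ℝ)..π, q s) α
  have hθπ : 0 < θ π := by
    simpa using hθ.int_mul_pi_lt (n := 0) (by simpa using hα.1) π (right_mem_Ioc.2 pi_pos)
  have hle : β ≤ θ π := le_of_sin_add_eq_zero hβ.2 hβδ hθπ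
    (hθ.sin_right_add_eq_zero hq hαγ (by rwa [sub_add_cancel]))
  obtain ⟨k, hk, φ, hφ, hφ0, rfl⟩ := hθ.exists_le_right_eq pi_pos hQ hα.2 hβ.1 rfl hle
  exact ⟨_, le_sub_iff_add_le.1 hk,
    hφ.hasPositiveEigenfunction hq (hφ0 ▸ hα.1) hβ.2 (hφ0 ▸ hαγ) hβδ⟩

theorem HasPositiveEigenfunction.isLowestEigenvalue {q : ℝ → ℝ} {γ δ m : ℝ}
    (hq : IntervalIntegrable q volume 0 π) (hm : HasPositiveEigenfunction q γ δ m) :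
    IsLowestEigenvalue q γ δ m := by
  have hm_eigenvalue : IsEigenvalue q γ δ m := by
    obtain ⟨y, hy, -⟩ := hm
    exact isEigenvalue_iff_exists_isEigenfunction.2 ⟨_, hy⟩
  refine ⟨hm_eigenvalue, fun μ hμ => ?_⟩
  obtain ⟨z, hz⟩ := isEigenvalue_iff_exists_isEigenfunction.1 hμ
  lift μ to ℝ using hz.im_eq_zero hq
  obtain ⟨n, hn, hn_pos⟩ := exists_hasPositiveEigenfunction_le hq hμ
  exact ⟨Complex.ofReal_im μ, (hm.le hq hn_pos).trans hn⟩

theorem IsLowestEigenvalue.mu0_eq {q : ℝ → ℝ} {γ δ m : ℝ} (hm : IsLowestEigenvalue q γ δ m) :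
    mu0 q γ δ = m :=
  IsLeast.csInf_eq ⟨hm.1, fun n hn => (hm.2 n hn).2⟩

theorem hasPositiveEigenfunction_mu0 {q : ℝ → ℝ} (hq : IntervalIntegrable q volume 0 π)
    (γ δ : ℝ) : HasPositiveEigenfunction q γ δ (mu0 q γ δ) := by
  obtain ⟨m, hm⟩ := exists_hasPositiveEigenfunction hq γ δ
  rwa [(hm.isLowestEigenvalue hq).mu0_eq]

end SturmLiouville

open SturmLiouville in
theorem theorem3p1_general (q p : ℝ → ℝ) (hq : IntegrableOn q (Set.Ioo 0 Real.pi) volume)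
    (hp : IntegrableOn p (Set.Ioo 0 Real.pi) volume) (γ δ : ℝ) :
    IsLowestEigenvalue q γ δ (mu0 q γ δ) ∧ IsLowestEigenvalue p γ δ (mu0 p γ δ) ∧
    essInf (fun x => ((q x - p x : ℝ) : EReal)) vol ≤ ((mu0 q γ δ - mu0 p γ δ : ℝ) : EReal) ∧
    ((mu0 q γ δ - mu0 p γ δ : ℝ) : EReal) ≤ essSup (fun x => ((q x - p x : ℝ) : EReal)) vol := by
  rw [← intervalIntegrable_iff_integrableOn_Ioo_of_le Real.pi_pos.le] at hq hp
  have hmq := hasPositiveEigenfunction_mu0 hq γ δ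
  have hmp := hasPositiveEigenfunction_mu0 hp γ δ
  refine ⟨hmq.isLowestEigenvalue hq, hmp.isLowestEigenvalue hp, ?_, ?_⟩
  · by_contra! hlt
    exact hmq.not_ae_lt_sub hq hp hmp
      ((ae_lt_of_lt_essInf hlt).mono fun x hx => EReal.coe_lt_coe_iff.1 hx)
  · by_contra! hlt
    exact hmq.not_ae_sub_lt hq hp hmp
      ((ae_lt_of_essSup_lt hlt).mono fun x hx => EReal.coe_lt_coe_iff.1 hx)

theorem theorem3p1 (q : ℝ → ℝ) (hq : IntegrableOn q (Set.Ioo 0 Real.pi) volume)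
    (γ δ : ℝ) (hγ : γ ∈ Set.Ioc 0 Real.pi) (hδ : δ ∈ Set.Ico 0 Real.pi) :
    SturmLiouville.IsLowestEigenvalue q γ δ (SturmLiouville.mu0 q γ δ) ∧
    SturmLiouville.IsLowestEigenvalue 0 γ δ (SturmLiouville.mu0 0 γ δ) ∧
    essInf (fun x => (q x : EReal)) SturmLiouville.vol ≤
      ((SturmLiouville.mu0 q γ δ - SturmLiouville.mu0 0 γ δ : ℝ) : EReal) ∧
    ((SturmLiouville.mu0 q γ δ - SturmLiouville.mu0 0 γ δ : ℝ) : EReal) ≤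
      essSup (fun x => (q x : EReal)) SturmLiouville.vol := by
  simpa using theorem3p1_general q 0 hq (integrable_zero _ _ _) γ δ
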